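/- A $k$-CNF formula is a finite set of clauses, each of which is a set of exactly $k$ distinct literals (variables or negated variables). A $(k,s)$-CNF formula is a $k$-CNF formula in which every variable occurs (positively or negatively) in at most $s$ clauses. The neighborhood of a clause $C$ of a formula is the set of the other clauses of the formula that share at least one variable with $C$; the maximum neighborhood size of the formula is the maximum of the sizes of these neighborhoods (and $0$ for the empty formula). Let $$f(k)=\max\{s\in\mathbb N:\text{ every }(k,s)\text{-CNF formula is satisfiable}\},$$ $$l(k)=\max\{t\in\mathbb N:\text{ every }k\text{-CNF formula with maximum neighborhood size at most }t\text{ is satisfiable}\}.$$ Theorem. Let $c=\frac{64}{63}$. For every sufficiently large integer $k$ such that $ck$ is a power of $2$, both maxima exist and (i) $f(k)\le \dfrac{2^{k}}{ck}-1$, and (ii) $l(k)\le \dfrac{2^{k-1}}{c}-1$. -/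

import Mathlib

namespace KSat

/-- A literal over the variable set `V`: `(x, true)` is the literal `x` and `(x, false)` is its
negation. -/
abbrev Literal (V : Type*) := V × Bool

/-- A clause is the disjunction of a finite set of (hence distinct) literals. -/
abbrev Clause (V : Type*) := Finset (Literal V)

/-- A boolean formula in conjunctive normal form is the conjunction of a finite set of clauses. -/
abbrev CNF (V : Type*) := Finset (Clause V)

/-- Some truth assignment makes at least one literal of every clause true. -/
def Satisfiable {V : Type*} (F : CNF V) : Prop :=
  ∃ a : V → Bool, ∀ C ∈ F, ∃ u ∈ C, a u.1 = u.2

section Counts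

variable {V : Type*} [DecidableEq V]

/-- The set of variables that occur in the clause `C`, positively or negatively. -/
def vars (C : Clause V) : Finset V := C.image Prod.fst

/-- The number of clauses of `F` in which the variable `x` occurs. -/
def occurrences (F : CNF V) (x : V) : ℕ := (F.filter fun C => x ∈ vars C).card

/-- The neighborhood of `C` in `F`: the other clauses of `F` that share a variable with `C`. -/
def neighborhood (F : CNF V) (C : Clause V) : Finset (Clause V) :=
  F.filter fun D => D ≠ C ∧ (vars C ∩ vars D).Nonempty

/-- The maximum size of the neighborhood of a clause of `F` (`0` for the empty formula). -/
def maxNeighborhood (F : CNF V) : ℕ := F.sup fun C => (neighborhood F C).card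

end Counts

/-- `F` is a `k`-CNF formula: each clause has exactly `k` distinct literals. -/
def IsKCNF {V : Type*} (k : ℕ) (F : CNF V) : Prop := ∀ C ∈ F, C.card = k

/-- `F` is a `(k, s)`-CNF formula: a `k`-CNF formula in which each variable occurs in at most `s`
clauses. -/
def IsKSCNF {V : Type*} [DecidableEq V] (k s : ℕ) (F : CNF V) : Prop :=
  IsKCNF k F ∧ ∀ x, occurrences F x ≤ s

/-- The `s` such that every `(k, s)`-CNF formula is satisfiable. Formulas are finite, so we can
name the variables by natural numbers. -/
def fSet (k : ℕ) : Set ℕ := {s | ∀ F : CNF ℕ, IsKSCNF k s F → Satisfiable F}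

/-- The `t` such that every `k`-CNF formula with maximum neighborhood size at most `t` is
satisfiable. -/
def lSet (k : ℕ) : Set ℕ :=
  {t | ∀ F : CNF ℕ, IsKCNF k F → maxNeighborhood F ≤ t → Satisfiable F}

/-- `f k` is the largest `s` such that every `(k, s)`-CNF formula is satisfiable. -/
noncomputable def f (k : ℕ) : ℕ := sSup (fSet k)

/-- `l k` is the largest `t` such that every `k`-CNF formula with maximum neighborhood size at
most `t` is satisfiable. -/
noncomputable def l (k : ℕ) : ℕ := sSup (lSet k)

end KSat

/-! Let `n = k - 1`, `c * k = 2 ^ m` and `d = 2 ^ (n - m)`. It suffices to find a binary tree whose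
leaves all have depth at least `k` and in which every vertex has at most `d` leaf descendants within
distance `n` (`exists_unsatisfiable`). Vertices serve as variables, and each leaf gives the clause
of its last `k` edges. Any assignment leads to a falsified leaf, a variable occurs in at most `2 *
d` clauses, and a clause has at most `k * d` neighbours; these are the two bounds plus one.

The tree is built downwards, tracking how many leaves a vertex may have at each distance. Such a
vector can be completed at once when its Kraft weight is at least 1 (`constructible_of_kraft`).
Passing half of it to each child keeps the Kraft weight up to rounding and adds new leaves at
distance `n`, but this alone stays below weight 1/2. Hence the asymmetric round `Feasible.of_cut`:
one of four grandchildren takes the entries nearest the root and is completed, while the other three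
share the rest, whose weight grows by the factor 4/3. Finitely many rounds, verified by computation
in `completes_uniform`, reach weight 1. -/

namespace KSat

/-! ### Binary trees and Kraft's inequality -/

/-- Finite binary trees in which every inner node has exactly two children. -/
inductive BinTree
  | leaf : BinTree
  | node : BinTree → BinTree → BinTree

namespace BinTree

/-- The number of leaves at distance `i` from the root. -/
def leavesAt : BinTree → ℕ → ℕ
  | leaf, 0 => 1
  | leaf, _ + 1 => 0
  | node _ _, 0 => 0
  | node a b, i + 1 => a.leavesAt i + b.leavesAt i

/-- The total number of leaves. -/
def numLeaves : BinTree → ℕ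
  | leaf => 1
  | node a b => a.numLeaves + b.numLeaves

/-- Every vertex has at most `d` leaf descendants at distance at most `n`. -/
def Bounded (n d : ℕ) : BinTree → Prop
  | leaf => 1 ≤ d
  | node a b => a.Bounded n d ∧ b.Bounded n d ∧
      ∑ i ∈ Finset.range (n + 1), (node a b).leavesAt i ≤ d

theorem sum_leavesAt_le_numLeaves (t : BinTree) (M : ℕ) :
    ∑ i ∈ Finset.range M, t.leavesAt i ≤ t.numLeaves := by
  induction t generalizing M with
  | leaf =>
    cases M with
    | zero => simp
    | succ M => simp [Finset.sum_range_succ', leavesAt, numLeaves]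
  | node a b iha ihb =>
    cases M with
    | zero => simp
    | succ M =>
      have ha := iha M
      have hb := ihb M
      simp only [Finset.sum_range_succ', leavesAt, numLeaves, Finset.sum_add_distrib]
      omega

theorem bounded_of_numLeaves_le {n d : ℕ} (t : BinTree) (h : t.numLeaves ≤ d) :
    t.Bounded n d := by
  induction t with
  | leaf => exact h
  | node a b iha ihb =>
    have h' : a.numLeaves + b.numLeaves ≤ d := h
    exact ⟨iha (by omega), ihb (by omega), (sum_leavesAt_le_numLeaves _ _).trans h⟩

theorem Bounded.sum_le {n d : ℕ} {t : BinTree} (h : t.Bounded n d) :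
    ∑ i ∈ Finset.range (n + 1), t.leavesAt i ≤ d := by
  cases t with
  | leaf => exact (sum_leavesAt_le_numLeaves _ _).trans h
  | node a b => exact h.2.2

/-- Pairing up the trees of a list. -/
def pairUp : List BinTree → List BinTree
  | a :: b :: l => node a b :: pairUp l
  | _ => []

theorem length_pairUp : ∀ l : List BinTree, (pairUp l).length = l.length / 2
  | [] => by simp [pairUp]
  | [_] => by simp [pairUp]
  | a :: b :: l => by
    simp only [pairUp, List.length_cons, length_pairUp l]
    omega

theorem leavesAt_pairUp_zero : ∀ l : List BinTree, ((pairUp l).map (leavesAt · 0)).sum = 0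
  | [] => by simp [pairUp]
  | [_] => by simp [pairUp]
  | a :: b :: l => by simp [pairUp, leavesAt_pairUp_zero l, leavesAt]

theorem leavesAt_pairUp_succ (i : ℕ) : ∀ l : List BinTree,
    ((pairUp l).map (leavesAt · (i + 1))).sum ≤ (l.map (leavesAt · i)).sum
  | [] => by simp [pairUp]
  | [_] => by simp [pairUp]
  | a :: b :: l => by
    have := leavesAt_pairUp_succ i l
    simp only [pairUp, leavesAt, List.map_cons, List.sum_cons]
    omega

theorem numLeaves_pairUp : ∀ l : List BinTree,
    ((pairUp l).map numLeaves).sum ≤ (l.map numLeaves).sum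
  | [] => by simp [pairUp]
  | [_] => by simp [pairUp]
  | a :: b :: l => by
    have := numLeaves_pairUp l
    simp only [pairUp, numLeaves, List.map_cons, List.sum_cons]
    omega

/-- A forest form of the converse of Kraft's inequality. -/
theorem exists_forest (M : ℕ) : ∀ x : ℕ → ℕ, ∃ l : List BinTree,
    l.length = (∑ i ∈ Finset.range (M + 1), x i * 2 ^ (M - i)) / 2 ^ M ∧
    (∀ i ≤ M, (l.map (leavesAt · i)).sum ≤ x i) ∧
    (l.map numLeaves).sum ≤ ∑ i ∈ Finset.range (M + 1), x i := by
  induction M with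
  | zero =>
    intro x
    refine ⟨List.replicate (x 0) leaf, by simp, ?_, by simp [numLeaves]⟩
    intro i hi
    obtain rfl : i = 0 := by omega
    simp [leavesAt]
  | succ M ih =>
    intro x
    obtain ⟨l, h1, h2, h3⟩ := ih fun i => x (i + 1)
    refine ⟨List.replicate (x 0) leaf ++ pairUp l, ?_, ?_, ?_⟩
    -- `pairUp` drops an unpaired tree, which matches the floor: successive floors compose to the
    -- floor of the quotient by `2 ^ (M + 1)`.
    · rw [Finset.sum_range_succ', List.length_append, List.length_replicate, length_pairUp, h1]
      simp only [Nat.add_sub_add_right, Nat.sub_zero]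
      rw [Nat.add_mul_div_right _ _ (by positivity), Nat.div_div_eq_div_mul, ← pow_succ, add_comm]
    · intro i hi
      cases i with
      | zero => simp [leavesAt_pairUp_zero, leavesAt]
      | succ i =>
        have h4 := leavesAt_pairUp_succ i l
        have h5 := h2 i (by omega)
        simp only [List.map_append, List.map_replicate, List.sum_append, leavesAt,
          List.sum_replicate, smul_zero, zero_add]
        exact h4.trans h5
    · have h4 := numLeaves_pairUp l
      rw [Finset.sum_range_succ']
      simp only [List.map_append, List.map_replicate, List.sum_append, numLeaves,
        List.sum_replicate, smul_eq_mul, mul_one]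
      omega

end BinTree

open BinTree

/-! ### Leaf vectors and their passage to children -/

/-- Some tree that satisfies the descendant bound has, for each `j ≤ n`, at most `x j` leaves at
distance `n - j` from the root. -/
def Constructible (n d : ℕ) (x : ℕ → ℕ) : Prop :=
  ∃ t : BinTree, t.Bounded n d ∧ ∀ j ≤ n, t.leavesAt (n - j) ≤ x j

theorem Constructible.mono {n d : ℕ} {x y : ℕ → ℕ} (h : Constructible n d x)
    (hxy : ∀ j ≤ n, x j ≤ y j) : Constructible n d y := by
  obtain ⟨t, ht, hx⟩ := h
  exact ⟨t, ht, fun j hj => (hx j hj).trans (hxy j hj)⟩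

/-- Moving to a child shifts positions by one. Entry 0 of a child concerns distance `n + 1` from the
parent, so the parent does not restrict it. -/
theorem Constructible.node {n d : ℕ} {x y z : ℕ → ℕ} (hy : Constructible n d y)
    (hz : Constructible n d z) (hx : ∀ j < n, y (j + 1) + z (j + 1) ≤ x j)
    (hd : ∑ j ∈ Finset.range (n + 1), x j ≤ d) : Constructible n d x := by
  obtain ⟨a, ha, hay⟩ := hy
  obtain ⟨b, hb, hbz⟩ := hz
  have key : ∀ j ≤ n, (BinTree.node a b).leavesAt (n - j) ≤ x j := by
    intro j hj
    rcases hj.eq_or_lt with rfl | hlt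
    · simp [leavesAt]
    · rw [show n - j = n - (j + 1) + 1 by omega]
      exact (add_le_add (hay _ hlt) (hbz _ hlt)).trans (hx j hlt)
  refine ⟨BinTree.node a b, ⟨ha, hb, ?_⟩, key⟩
  rw [← Finset.sum_range_reflect]
  refine (Finset.sum_le_sum fun j hj => ?_).trans hd
  rw [Finset.mem_range] at hj
  rw [Nat.add_sub_cancel]
  exact key j (by omega)

/-- Any tree of the Kraft forest works: it has at most `d` leaves altogether, so the descendant
bound is automatic. -/
theorem constructible_of_kraft {n d : ℕ} {x : ℕ → ℕ}
    (hx : 2 ^ n ≤ ∑ j ∈ Finset.range (n + 1), x j * 2 ^ j)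
    (hd : ∑ j ∈ Finset.range (n + 1), x j ≤ d) : Constructible n d x := by
  obtain ⟨l, h1, h2, h3⟩ := exists_forest n fun i => x (n - i)
  have e1 : ∑ i ∈ Finset.range (n + 1), x (n - i) * 2 ^ (n - i) =
      ∑ j ∈ Finset.range (n + 1), x j * 2 ^ j := by
    rw [← Finset.sum_range_reflect (fun j => x j * 2 ^ j)]
    simp
  have e2 : ∑ i ∈ Finset.range (n + 1), x (n - i) = ∑ j ∈ Finset.range (n + 1), x j := by
    rw [← Finset.sum_range_reflect x]
    simp
  rw [e1] at h1
  have hlen : 0 < l.length := by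
    rw [h1]
    exact Nat.div_pos hx (by positivity)
  obtain ⟨t, l, rfl⟩ := List.exists_cons_of_length_pos hlen
  simp only [List.map_cons, List.sum_cons] at h2 h3
  refine ⟨t, bounded_of_numLeaves_le t (by omega), fun j hj => ?_⟩
  have := h2 (n - j) (by omega)
  rw [Nat.sub_sub_self hj] at this
  omega

/-- Constructibility under the necessary condition that the vector has total at most `d`. -/
def Feasible (n d : ℕ) (x : ℕ → ℕ) : Prop :=
  ∑ j ∈ Finset.range (n + 1), x j ≤ d → Constructible n d x

theorem sum_range_shift_le (n : ℕ) (x : ℕ → ℕ) :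
    ∑ j ∈ Finset.range n, x j ≤ ∑ j ∈ Finset.range (n + 1), x j :=
  Finset.sum_le_sum_of_subset (Finset.range_mono (by omega))

/-- The inherited half and the new entry `d / 2` each total at most `d / 2`, so the budget `d` is
respected again. -/
theorem Feasible.of_halve {n d : ℕ} {x y : ℕ → ℕ} (h : Feasible n d y) (h0 : y 0 = d / 2)
    (hs : ∀ j, y (j + 1) = x j / 2) : Feasible n d x := by
  intro hd
  have hy : Constructible n d y := by
    apply h
    rw [Finset.sum_range_succ', h0]
    have h1 : 2 * ∑ j ∈ Finset.range n, y (j + 1) ≤ ∑ j ∈ Finset.range n, x j := by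
      rw [Finset.mul_sum]
      refine Finset.sum_le_sum fun j _ => ?_
      rw [hs]
      omega
    have h2 := sum_range_shift_le n x
    omega
  refine hy.node hy (fun j _ => ?_) hd
  rw [hs]
  omega

/-- Halving `t` times. -/
theorem Feasible.of_iterate_halve {n d : ℕ} {x : ℕ → ℕ} (t : ℕ)
    (h : Feasible n d fun j => if j < t then d / 2 ^ (j + 1) else x (j - t) / 2 ^ t) :
    Feasible n d x := by
  induction t with
  | zero => simpa using h
  | succ t ih =>
    apply ih
    refine h.of_halve (by simp) fun j => ?_
    by_cases hj : j < t
    · simp [hj, Nat.div_div_eq_div_mul, pow_succ]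
    · simp [hj, Nat.div_div_eq_div_mul, pow_succ]

/-- One of the four grandchildren of the root is completed with the entries of `x` at positions
`≥ a`; each of the others gets a third of the remaining entries. -/
theorem Feasible.of_cut {n d : ℕ} {x g : ℕ → ℕ} (a : ℕ) (h : Feasible n d g)
    (g0 : g 0 = 0) (g1 : g 1 = 0) (hg : ∀ j, g (j + 2) = if j < a then x j / 3 else 0)
    (hn : 2 ≤ n)
    (hk : 2 ^ n ≤ 4 * ∑ j ∈ Finset.range (n - 1), (if a ≤ j then x j else 0) * 2 ^ j) :
    Feasible n d x := by
  intro hd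
  obtain ⟨r, rfl⟩ : ∃ r, n = r + 2 := ⟨n - 2, by omega⟩
  -- The completed grandchild has vector `c`, its sibling and both cousins have `g`. The shift by
  -- two levels multiplies Kraft weight by 4, so a quarter suffices for `c`.
  let c : ℕ → ℕ := fun j => if 2 ≤ j then (if a ≤ j - 2 then x (j - 2) else 0) else 0
  have hc : ∀ j, c (j + 2) = if a ≤ j then x j else 0 := fun j => by simp [c]
  have c0 : c 0 = 0 := by simp [c]
  have c1 : c 1 = 0 := by simp [c]
  have hcg : ∀ j, c (j + 2) + 3 * g (j + 2) ≤ x j := by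
    intro j
    rw [hc, hg]
    by_cases hj : j < a
    · rw [if_neg (by omega), if_pos hj]
      omega
    · rw [if_pos (by omega), if_neg hj]
      omega
  have hx1 : ∑ j ∈ Finset.range (r + 1), x j ≤ d :=
    (sum_range_shift_le _ _).trans ((sum_range_shift_le _ _).trans hd)
  have hx2 : ∑ j ∈ Finset.range (r + 2), x j ≤ d := (sum_range_shift_le _ _).trans hd
  have hC : Constructible (r + 2) d c := by
    apply constructible_of_kraft
    · rw [Finset.sum_range_succ', Finset.sum_range_succ']
      refine hk.trans ?_
      rw [c0, zero_mul, add_zero, show c (0 + 1) = 0 from c1, zero_mul, add_zero, Finset.mul_sum]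
      refine Finset.sum_le_sum fun j _ => ?_
      rw [show j + 1 + 1 = j + 2 from rfl, hc, pow_add]
      linarith
    · rw [Finset.sum_range_succ', Finset.sum_range_succ', c0, show c (0 + 1) = 0 from c1, add_zero, add_zero]
      refine le_trans (Finset.sum_le_sum fun j _ => ?_) hx1
      have := hcg j
      rw [show j + 1 + 1 = j + 2 from rfl]
      omega
  have hG : Constructible (r + 2) d g := by
    apply h
    rw [Finset.sum_range_succ', Finset.sum_range_succ', g0, show g (0 + 1) = 0 from g1, add_zero, add_zero]
    refine le_trans (Finset.sum_le_sum fun j _ => ?_) hx1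
    have := hcg j
    rw [show j + 1 + 1 = j + 2 from rfl]
    omega
  have hu : Constructible (r + 2) d fun j => c (j + 1) + g (j + 1) := by
    refine hC.node hG (fun j _ => le_rfl) ?_
    rw [Finset.sum_range_succ', show c (0 + 1) = 0 from c1, show g (0 + 1) = 0 from g1,
      add_zero, add_zero]
    refine le_trans (Finset.sum_le_sum fun j _ => ?_) hx2
    have := hcg j
    rw [show j + 1 + 1 = j + 2 from rfl]
    omega
  have hv : Constructible (r + 2) d fun j => g (j + 1) + g (j + 1) := by
    refine hG.node hG (fun j _ => le_rfl) ?_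
    rw [Finset.sum_range_succ', show g (0 + 1) = 0 from g1, add_zero, add_zero]
    refine le_trans (Finset.sum_le_sum fun j _ => ?_) hx2
    have := hcg j
    rw [show j + 1 + 1 = j + 2 from rfl]
    omega
  refine hu.node hv (fun j _ => ?_) hd
  have := hcg j
  simp only [show j + 1 + 1 = j + 2 from rfl]
  omega


/-! ### Block weights and rounds -/

/-- The positions below `31 * L` are divided into blocks of length `L`. In the block with index `b`
the Kraft weight of each position, except for the last two positions, is proportional to the entry
`b` of the list `w`. -/
def blockVector (L d Q : ℕ) (w : List ℕ) (j : ℕ) : ℕ :=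
  if j % L + 2 < L then w.getD (j / L) 0 * d / (Q * 2 ^ j) else 0

/-- The block weights after the last `T` blocks have been used to complete a fourth of the
descendants and the other blocks have moved by `T` blocks. -/
def advance (S T : ℕ) (w : List ℕ) : List ℕ :=
  List.replicate T S ++ (w.take (31 - T)).map fun v => 4 * v / 3

/-- The total weight of the blocks with index between `s` and `30`. -/
def tailWeight (s : ℕ) (w : List ℕ) : ℕ :=
  ∑ b ∈ Finset.range 31, if s ≤ b then w.getD b 0 else 0

theorem sum_range_blocks (f : ℕ → ℕ) (B L : ℕ) :
    ∑ j ∈ Finset.range (B * L), f j =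
      ∑ b ∈ Finset.range B, ∑ r ∈ Finset.range L, f (b * L + r) := by
  induction B with
  | zero => simp
  | succ B ih => rw [add_mul, one_mul, Finset.sum_range_add, ih, Finset.sum_range_succ]

theorem le_mul_div_add (a Q p : ℕ) (hQ : 0 < Q) (hp : 0 < p) :
    a ≤ Q * (a / (Q * p) * p) + Q * p := by
  have h := Nat.lt_div_mul_add (a := a) (b := Q * p) (by positivity)
  have : a / (Q * p) * (Q * p) = Q * (a / (Q * p) * p) := by ring
  omega

theorem sum_range_two_pow_le (M : ℕ) : ∑ j ∈ Finset.range M, 2 ^ j ≤ 2 ^ M := by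
  have := Nat.geomSum_lt (m := 2) (n := M) (s := Finset.range M) le_rfl
    fun k hk => Finset.mem_range.1 hk
  exact this.le

/-- Rounding costs at most `2 ^ j` of Kraft weight at position `j`, hence at most `2 ^ (31 * L)` in
total. -/
theorem tailWeight_mul_le {L d Q : ℕ} (hL : 2 ≤ L) (hQ : 0 < Q) (s : ℕ) (w : List ℕ) :
    tailWeight s w * ((L - 2) * d) ≤ Q * ∑ j ∈ Finset.range (31 * L),
      (if s * L ≤ j then blockVector L d Q w j else 0) * 2 ^ j + Q * 2 ^ (31 * L) := by
  have hL0 : 0 < L := by omega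
  refine le_trans ?_ (Nat.add_le_add_left
    (Nat.mul_le_mul_left Q (sum_range_two_pow_le (31 * L))) _)
  rw [← mul_add, ← Finset.sum_add_distrib, sum_range_blocks, tailWeight, Finset.sum_mul,
    Finset.mul_sum]
  refine Finset.sum_le_sum fun b _ => ?_
  split_ifs with hs
  swap
  · simp
  have h1 : ∑ r ∈ Finset.range (L - 2), w.getD b 0 * d = w.getD b 0 * ((L - 2) * d) := by
    simp
    ring
  rw [← h1, Finset.mul_sum]
  refine (Finset.sum_le_sum fun r hr => ?_).trans
    (Finset.sum_le_sum_of_subset (Finset.range_mono (by omega : L - 2 ≤ L)))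
  rw [Finset.mem_range] at hr
  have hmod : (b * L + r) % L = r := by
    rw [Nat.mul_add_mod', Nat.mod_eq_of_lt (by omega)]
  have hdiv : (b * L + r) / L = b := by
    rw [mul_comm, Nat.mul_add_div hL0, Nat.div_eq_of_lt (by omega), add_zero]
  have hle : s * L ≤ b * L + r := (Nat.mul_le_mul_right L hs).trans (by omega)
  rw [if_pos hle, blockVector, hmod, hdiv, if_pos (by omega), mul_add]
  exact le_mul_div_add _ _ _ hQ (by positivity)

/-- The parameters: `n + 1` is the clause width, `d` the number of leaves that a vertex may have at
distance at most `n`, and `L` the length of a block. -/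
structure Scale (n d L : ℕ) : Prop where
  two_le : 2000 ≤ L
  pow_eq : 32 * (L * d) = 2 ^ n
  even : 2 * (d / 2) = d
  room : 31 * L + 10 ≤ n

/-- `M` is the required Kraft weight in units of 1/32: 32 for a full completion, 8 for a quarter.
The slack of one per cent pays for the two blank positions per block (at most 1/1000, as `2000 ≤ L`)
and for the rounding, at most `2 ^ n / 1000` by `room`. -/
theorem Scale.kraft {n d L Q : ℕ} (h : Scale n d L) (hQ : 0 < Q) {M s : ℕ} (hM : 8 ≤ M)
    {w : List ℕ} (hw : 101 * M * Q ≤ 100 * tailWeight s w) :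
    M * 2 ^ n ≤ 32 * ∑ j ∈ Finset.range (31 * L),
      (if s * L ≤ j then blockVector L d Q w j else 0) * 2 ^ j := by
  have h1 := tailWeight_mul_le (d := d) (Nat.le_trans (by norm_num) h.two_le) hQ s w
  set A := ∑ j ∈ Finset.range (31 * L),
      (if s * L ≤ j then blockVector L d Q w j else 0) * 2 ^ j
  have h2 : 1000 * 2 ^ (31 * L) ≤ 2 ^ n := by
    calc 1000 * 2 ^ (31 * L) ≤ 2 ^ 10 * 2 ^ (31 * L) := Nat.mul_le_mul_right _ (by norm_num)
      _ = 2 ^ (31 * L + 10) := by rw [pow_add]; ring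
      _ ≤ 2 ^ n := Nat.pow_le_pow_right (by norm_num) h.room
  have h3 : 999 * L ≤ 1000 * (L - 2) := by have := h.two_le; omega
  have h4 := h.pow_eq
  refine Nat.le_of_mul_le_mul_left (c := 100000 * Q) ?_ (by positivity)
  have e1 : 999 * (L * d) ≤ 1000 * ((L - 2) * d) := by
    calc 999 * (L * d) = 999 * L * d := by ring
      _ ≤ 1000 * (L - 2) * d := Nat.mul_le_mul_right _ h3
      _ = _ := by ring
  have e2 := Nat.mul_le_mul hw e1
  have e3 : Q * (1000 * 2 ^ (31 * L)) ≤ Q * 2 ^ n := Nat.mul_le_mul_left _ h2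
  have e4 : 8 * (Q * 2 ^ n) ≤ M * (Q * 2 ^ n) := Nat.mul_le_mul_right _ hM
  have e5 : 101 * M * Q * (999 * (L * d)) * 32 = 100899 * (M * (Q * 2 ^ n)) := by
    rw [← h4]; ring
  have e6 : 100 * tailWeight s w * (1000 * ((L - 2) * d)) =
      100000 * (tailWeight s w * ((L - 2) * d)) := by ring
  have e7 : 100000 * Q * (M * 2 ^ n) = 100000 * (M * (Q * 2 ^ n)) := by ring
  have e8 : 100000 * Q * (32 * A) = 3200000 * (Q * A) := by ring
  have e9 : Q * (1000 * 2 ^ (31 * L)) = 1000 * (Q * 2 ^ (31 * L)) := by ring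
  rw [e6] at e2
  rw [e7, e8]
  rw [e9] at e3
  omega

theorem sum_range_le_of_le {f : ℕ → ℕ} {M N : ℕ} (h : M ≤ N) :
    ∑ j ∈ Finset.range M, f j ≤ ∑ j ∈ Finset.range N, f j :=
  Finset.sum_le_sum_of_subset (Finset.range_mono h)

theorem Scale.feasible_of_tailWeight {n d L S : ℕ} (h : Scale n d L) (hS : 0 < S) {w : List ℕ}
    (hw : 101 * 32 * (2 * S) ≤ 100 * tailWeight 0 w) :
    Feasible n d (blockVector L d (2 * S) w) := by
  intro hd
  refine constructible_of_kraft ?_ hd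
  have h1 := h.kraft (by positivity) (by norm_num) hw
  simp only [zero_mul, Nat.zero_le, if_true] at h1
  refine (Nat.le_of_mul_le_mul_left h1 (by norm_num)).trans (sum_range_le_of_le ?_)
  have := h.room
  omega

theorem Feasible.mono {n d : ℕ} {x y : ℕ → ℕ} (h : Feasible n d x) (hxy : ∀ j, x j ≤ y j) :
    Feasible n d y := fun hd =>
  (h ((Finset.sum_le_sum fun j _ => hxy j).trans hd)).mono fun j _ => hxy j

/-- The cut descends two levels without new leaves, leaving two empty positions; these fall on the
blank end of a block. -/
theorem lt_of_mod_add_two_lt {L T j : ℕ} (hj : j < T * L) (hm : j % L + 2 < L) :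
    j + 2 < T * L := by
  have h0 : 0 < L := by omega
  have h1 : j / L < T := Nat.div_lt_of_lt_mul (by rwa [mul_comm])
  have h2 : (j / L + 1) * L ≤ T * L := Nat.mul_le_mul_right _ h1
  have h3 := Nat.mod_add_div j L
  have h4 : (j / L + 1) * L = L * (j / L) + L := by ring
  omega

theorem half_div_two_pow {d S : ℕ} (hS : 0 < S) (j : ℕ) :
    S * d / (2 * S * 2 ^ j) = d / 2 ^ (j + 1) := by
  rw [show 2 * S * 2 ^ j = S * 2 ^ (j + 1) by ring, Nat.mul_div_mul_left _ _ hS]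

theorem Scale.feasible_of_advance {n d L S : ℕ} (h : Scale n d L) (hS : 0 < S) {w : List ℕ}
    {T : ℕ} (hT0 : 0 < T) (hT : T ≤ 31)
    (hw : 101 * 8 * (2 * S) ≤ 100 * tailWeight (31 - T) w)
    (hf : Feasible n d (blockVector L d (2 * S) (advance S T w))) :
    Feasible n d (blockVector L d (2 * S) w) := by
  have hL := h.two_le
  have hn := h.room
  let g : ℕ → ℕ := fun j => if 2 ≤ j then
    (if j - 2 < (31 - T) * L then blockVector L d (2 * S) w (j - 2) / 3 else 0) else 0
  have hTL : L ≤ T * L := Nat.le_mul_of_pos_left L hT0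
  refine Feasible.of_cut (g := g) ((31 - T) * L) ?_ (by simp [g]) (by simp [g])
    (fun j => by simp [g]) (by omega) ?_
  -- With the two levels of the cut this makes `T * L` levels, a shift by exactly `T` blocks.
  · refine Feasible.of_iterate_halve (T * L - 2) (hf.mono fun j => ?_)
    rw [blockVector]
    split_ifs with h1 h2 h2
    · have h3 : j / L < T := Nat.div_lt_of_lt_mul (by rw [mul_comm]; omega)
      rw [advance, List.getD_append _ _ _ _ (by simpa using h3), List.getD_replicate _ h3,
        half_div_two_pow hS]
    · have hj : T * L ≤ j := by
        by_contra hlt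
        have := lt_of_mod_add_two_lt (not_le.1 hlt) h1
        omega
      obtain ⟨i, rfl⟩ := Nat.exists_eq_add_of_le hj
      have hdiv : (T * L + i) / L = T + i / L := by
        rw [mul_comm, Nat.mul_add_div (by omega)]
      have hmod : (T * L + i) % L = i % L := by rw [Nat.mul_add_mod']
      rw [hmod] at h1
      rw [hdiv, show T * L + i - (T * L - 2) = i + 2 by omega, advance,
        List.getD_append_right _ _ _ _ (by simp)]
      simp only [List.length_replicate, Nat.add_sub_cancel_left, g, Nat.add_sub_cancel,
        Nat.le_add_left, if_true]
      by_cases hi : i / L < 31 - T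
      · have hi' : i < (31 - T) * L := by
          exact Nat.lt_mul_of_div_lt hi (by omega)
        rw [if_pos hi', blockVector, if_pos h1]
        have hget : ((w.take (31 - T)).map fun v => 4 * v / 3).getD (i / L) 0 =
            4 * w.getD (i / L) 0 / 3 := by
          simp only [List.getD_eq_getElem?_getD, List.getElem?_map, List.getElem?_take, if_pos hi]
          cases w[i / L]? <;> simp
        rw [hget, Nat.div_div_eq_div_mul, Nat.div_div_eq_div_mul]
        set v := w.getD (i / L) 0
        have hp : 2 ^ (T * L) = 2 ^ (T * L - 2) * 4 := by
          rw [show (4 : ℕ) = 2 ^ 2 by norm_num, ← pow_add]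
          congr 1
          omega
        rw [pow_add, hp]
        set p := 2 ^ (T * L - 2)
        have hp0 : 0 < p := by positivity
        rw [← Nat.mul_div_mul_right _ (2 * S * (p * 4 * 2 ^ i)) (by norm_num : 0 < 3),
          ← Nat.mul_div_mul_right (v * d) _ (by norm_num : 0 < 4)]
        rw [show 2 * S * (p * 4 * 2 ^ i) * 3 = 2 * S * 2 ^ i * (3 * p) * 4 by ring]
        apply Nat.div_le_div_right
        have := Nat.div_mul_le_self (4 * v) 3
        calc 4 * v / 3 * d * 3 = 4 * v / 3 * 3 * d := by ring
          _ ≤ 4 * v * d := Nat.mul_le_mul_right _ this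
          _ = v * d * 4 := by ring
      · have hget : ((w.take (31 - T)).map fun v => 4 * v / 3).getD (i / L) 0 = 0 := by
          simp only [List.getD_eq_getElem?_getD, List.getElem?_map, List.getElem?_take, if_neg hi]
          simp
        rw [hget]
        simp
    · exact Nat.zero_le _
    · exact Nat.zero_le _
  · have h1 := h.kraft (by positivity) (by norm_num) hw
    have h2 : 2 ^ n ≤ 4 * ∑ j ∈ Finset.range (31 * L),
      (if (31 - T) * L ≤ j then blockVector L d (2 * S) w j else 0) * 2 ^ j := by omega
    exact h2.trans (Nat.mul_le_mul_left _ (sum_range_le_of_le (by omega)))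

/-- The weights `w` lead to a completed tree if the rounds of the list are performed. -/
def Completes (S : ℕ) : List ℕ → List ℕ → Prop
  | [], w => 101 * 32 * (2 * S) ≤ 100 * tailWeight 0 w
  | T :: Ts, w => 0 < T ∧ T ≤ 31 ∧ 101 * 8 * (2 * S) ≤ 100 * tailWeight (31 - T) w ∧
      Completes S Ts (advance S T w)

instance decidableCompletes (S : ℕ) : ∀ Ts w, Decidable (Completes S Ts w)
  | [], w => inferInstanceAs (Decidable (101 * 32 * (2 * S) ≤ 100 * tailWeight 0 w))
  | T :: Ts, w =>
    have := decidableCompletes S Ts (advance S T w)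
    inferInstanceAs (Decidable (0 < T ∧ T ≤ 31 ∧
      101 * 8 * (2 * S) ≤ 100 * tailWeight (31 - T) w ∧ Completes S Ts (advance S T w)))

theorem Scale.feasible_of_completes {n d L S : ℕ} (h : Scale n d L) (hS : 0 < S) :
    ∀ {Ts w : List ℕ}, Completes S Ts w → Feasible n d (blockVector L d (2 * S) w)
  | [], _, hc => h.feasible_of_tailWeight hS hc
  | _ :: _, _, ⟨h0, h1, h2, h3⟩ =>
    h.feasible_of_advance hS h0 h1 h2 (h.feasible_of_completes hS h3)

/-- With `S = 1000000`, the total starts at `31 * S` and must reach `64 * S` plus one per cent. The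
large `S` makes the rounding in `4 * v / 3` harmless. Each list entry is the number of tail blocks
spent in a round. -/
theorem completes_uniform : Completes 1000000
    [17, 13, 12, 11, 10, 10, 10, 9, 9, 9, 8, 8, 8, 7, 7, 7, 7, 6, 6, 6, 6, 6, 5]
    (List.replicate 31 1000000) := by
  decide +kernel

/-- Halving the zero vector `31 * L` times puts `d / 2 ^ (j + 1)` at position `j`, which is the
uniform weight `S` over `2 * S`. -/
theorem Scale.constructible_zero {n d L : ℕ} (h : Scale n d L) :
    Constructible n d fun _ => 0 := by
  have h1 := h.feasible_of_completes (by norm_num) completes_uniform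
  have h2 : Feasible n d fun _ => 0 := by
    refine Feasible.of_iterate_halve (31 * L) (h1.mono fun j => ?_)
    rw [blockVector]
    split_ifs with hm hj hj
    · have h3 : j / L < 31 := Nat.div_lt_of_lt_mul (by rwa [mul_comm])
      rw [List.getD_replicate _ h3, half_div_two_pow (by norm_num)]
    · have h3 : 31 ≤ j / L := by
        rw [Nat.le_div_iff_mul_le (by have := h.two_le; omega)]
        omega
      rw [List.getD_eq_default _ _ (by simpa using h3)]
      simp
    · exact Nat.zero_le _
    · exact Nat.zero_le _
  exact h2 (by simp)

/-! ### Leaves as paths, with suffixes as ancestors -/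

namespace BinTree

/-- The leaves of a tree whose root is at `p`. A vertex is given by the directions on the path to
it, the last one first. -/
def leaves : BinTree → List Bool → Finset (List Bool)
  | leaf, p => {p}
  | node a b, p => a.leaves (true :: p) ∪ b.leaves (false :: p)

theorem suffix_of_mem_leaves {t : BinTree} {p q : List Bool} (h : q ∈ t.leaves p) : p <:+ q := by
  induction t generalizing p with
  | leaf => simp only [leaves, Finset.mem_singleton] at h; rw [h]
  | node a b iha ihb =>
    rcases Finset.mem_union.1 h with h | h
    · exact (List.suffix_cons _ _).trans (iha h)
    · exact (List.suffix_cons _ _).trans (ihb h)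

theorem not_suffix_true_false {p q : List Bool} (h1 : (true :: p) <:+ q)
    (h2 : (false :: p) <:+ q) : False := by
  have := List.suffix_of_suffix_length_le h1 h2 (by simp)
  have := this.eq_of_length (by simp)
  simp at this

theorem eq_of_suffix_leaves {t : BinTree} {p q r : List Bool} (hq : q ∈ t.leaves p)
    (hr : r ∈ t.leaves p) (h : q <:+ r) : q = r := by
  induction t generalizing p with
  | leaf =>
    simp only [leaves, Finset.mem_singleton] at hq hr
    rw [hq, hr]
  | node a b iha ihb =>
    rcases Finset.mem_union.1 hq with h1 | h1 <;> rcases Finset.mem_union.1 hr with h2 | h2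
    · exact iha h1 h2
    · exact (not_suffix_true_false ((suffix_of_mem_leaves h1).trans h)
        (suffix_of_mem_leaves h2)).elim
    · exact (not_suffix_true_false (suffix_of_mem_leaves h2)
        ((suffix_of_mem_leaves h1).trans h)).elim
    · exact ihb h1 h2

theorem card_leaves_filter_length (t : BinTree) (p : List Bool) (i : ℕ) :
    ((t.leaves p).filter fun q => q.length = p.length + i).card ≤ t.leavesAt i := by
  induction t generalizing p i with
  | leaf =>
    cases i with
    | zero => exact (Finset.card_filter_le _ _).trans (by simp [leaves, leavesAt])
    | succ i => simp [leaves, leavesAt]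
  | node a b iha ihb =>
    cases i with
    | zero =>
      rw [leavesAt, Nat.le_zero, Finset.card_eq_zero, Finset.filter_eq_empty_iff]
      intro q hq hl
      rcases Finset.mem_union.1 hq with h | h
      · have := (suffix_of_mem_leaves h).length_le
        simp at this
        omega
      · have := (suffix_of_mem_leaves h).length_le
        simp at this
        omega
    | succ i =>
      have e : ∀ c : Bool, p.length + (i + 1) = (c :: p).length + i := fun c => by
        rw [List.length_cons]
        omega
      rw [leaves, Finset.filter_union]
      refine (Finset.card_union_le _ _).trans (add_le_add ?_ ?_)
      · rw [e true]
        exact iha _ i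
      · rw [e false]
        exact ihb _ i

theorem card_leaves_filter_length_le {n d : ℕ} {t : BinTree} (h : t.Bounded n d)
    (p : List Bool) :
    ((t.leaves p).filter fun q => q.length ≤ p.length + n).card ≤ d := by
  refine le_trans ?_ h.sum_le
  refine le_trans (Finset.card_le_card (t := (Finset.range (n + 1)).biUnion fun i =>
    (t.leaves p).filter fun q => q.length = p.length + i) ?_) (Finset.card_biUnion_le.trans
      (Finset.sum_le_sum fun i _ => t.card_leaves_filter_length p i))
  intro q hq
  rw [Finset.mem_filter] at hq
  have := (suffix_of_mem_leaves hq.1).length_le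
  simp only [Finset.mem_biUnion, Finset.mem_filter, Finset.mem_range]
  exact ⟨q.length - p.length, by omega, hq.1, by omega⟩

/-- The leaves below the vertex `q` at distance at most `n` from it. -/
def nearLeaves (t : BinTree) (p : List Bool) (n : ℕ) (q : List Bool) : Finset (List Bool) :=
  (t.leaves p).filter fun r => q <:+ r ∧ r.length ≤ q.length + n

theorem nearLeaves_node (a b : BinTree) (p : List Bool) (n : ℕ) (q : List Bool) :
    (node a b).nearLeaves p n q =
      a.nearLeaves (true :: p) n q ∪ b.nearLeaves (false :: p) n q :=
  Finset.filter_union _ _ _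

theorem suffix_of_mem_nearLeaves {t : BinTree} {p q r : List Bool} {n : ℕ} (c : Bool)
    (h : r ∈ t.nearLeaves (c :: p) n q) (hq : ¬ q <:+ p) : (c :: p) <:+ q := by
  rw [nearLeaves, Finset.mem_filter] at h
  rcases List.suffix_or_suffix_of_suffix h.2.1 (suffix_of_mem_leaves h.1) with h1 | h1
  · rcases List.suffix_cons_iff.1 h1 with h2 | h2
    · rw [h2]
    · exact (hq h2).elim
  · exact h1

/-- If `q` is at or above the root `p`, leaves near `q` are also near `p`; otherwise at most one of
the two subtrees has leaves below `q`. -/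
theorem card_nearLeaves_le {n d : ℕ} {t : BinTree} (h : t.Bounded n d) (p q : List Bool) :
    (t.nearLeaves p n q).card ≤ d := by
  induction t generalizing p with
  | leaf => exact (Finset.card_filter_le _ _).trans h
  | node a b iha ihb =>
    by_cases hq : q <:+ p
    · refine (Finset.card_le_card fun r hr => ?_).trans (card_leaves_filter_length_le h p)
      rw [nearLeaves, Finset.mem_filter] at hr
      rw [Finset.mem_filter]
      have := hq.length_le
      exact ⟨hr.1, by omega⟩
    · rw [nearLeaves_node]
      rcases (a.nearLeaves (true :: p) n q).eq_empty_or_nonempty with h1 | ⟨r, hr⟩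
      · rw [h1, Finset.empty_union]
        exact ihb h.2.1 _
      rcases (b.nearLeaves (false :: p) n q).eq_empty_or_nonempty with h2 | ⟨r', hr'⟩
      · rw [h2, Finset.union_empty]
        exact iha h.1 _
      exact (not_suffix_true_false (suffix_of_mem_nearLeaves _ hr hq)
        (suffix_of_mem_nearLeaves _ hr' hq)).elim

/-- Every assignment of directions to the vertices leads to a leaf. -/
theorem exists_leaf_following (t : BinTree) (a : List Bool → Bool) (p : List Bool)
    (hp : ∀ b s, (b :: s) <:+ p → b = a s) :
    ∃ q ∈ t.leaves p, ∀ b s, (b :: s) <:+ q → b = a s := by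
  induction t generalizing p with
  | leaf => exact ⟨p, by simp [leaves], hp⟩
  | node l r ihl ihr =>
    have hc : ∀ c, c = a p → ∀ b s, (b :: s) <:+ (c :: p) → b = a s := by
      intro c hc b s hs
      rcases List.suffix_cons_iff.1 hs with h | h
      · obtain ⟨rfl, rfl⟩ := List.cons.inj h
        exact hc
      · exact hp b s h
    cases ha : a p with
    | true =>
      obtain ⟨q, hq, h⟩ := ihl (true :: p) (hc _ ha.symm)
      exact ⟨q, Finset.mem_union_left _ hq, h⟩
    | false =>
      obtain ⟨q, hq, h⟩ := ihr (false :: p) (hc _ ha.symm)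
      exact ⟨q, Finset.mem_union_right _ hq, h⟩

end BinTree

/-! ### The formula of a tree -/

open BinTree

/-- The clause of the vertex `q`: one literal for each of the last `k` edges on the path to `q`. -/
def pathClause (k : ℕ) (q : List Bool) : Clause ℕ :=
  (Finset.range k).image fun i => (Encodable.encode (q.drop (i + 1)), q.getD i true)

theorem card_pathClause {k : ℕ} {q : List Bool} (h : k ≤ q.length) :
    (pathClause k q).card = k := by
  rw [pathClause, Finset.card_image_of_injOn, Finset.card_range]
  intro i hi j hj hij
  simp only [Finset.coe_range, Set.mem_Iio] at hi hj
  have h1 := congrArg List.length (Encodable.encode_injective (congrArg Prod.fst hij))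
  simp only [List.length_drop] at h1
  omega

theorem cons_getD_drop {q : List Bool} {i : ℕ} (h : i < q.length) :
    q.getD i true :: q.drop (i + 1) = q.drop i := by
  rw [List.getD_eq_getElem _ _ h, ← List.drop_eq_getElem_cons]

theorem mem_vars_pathClause {k x : ℕ} {q : List Bool} :
    x ∈ vars (pathClause k q) ↔ ∃ i < k, Encodable.encode (q.drop (i + 1)) = x := by
  simp [vars, pathClause]

/-- The formula with a clause for each leaf. -/
def treeFormula (k : ℕ) (t : BinTree) : CNF ℕ := (t.leaves []).image (pathClause k)

theorem not_satisfiable_treeFormula {k : ℕ} {t : BinTree} (h : ∀ q ∈ t.leaves [], k ≤ q.length) :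
    ¬ Satisfiable (treeFormula k t) := by
  rintro ⟨a, ha⟩
  -- Walking against the assignment falsifies every literal on the path.
  obtain ⟨q, hq, hf⟩ := t.exists_leaf_following (fun s => !a (Encodable.encode s)) []
    (by simp)
  obtain ⟨u, hu, h1⟩ := ha _ (Finset.mem_image_of_mem _ hq)
  obtain ⟨i, hi, rfl⟩ := Finset.mem_image.1 hu
  have hlen := h q hq
  rw [Finset.mem_range] at hi
  have h2 := hf (q.getD i true) (q.drop (i + 1)) (by
    rw [cons_getD_drop (by omega)]
    exact List.drop_suffix _ _)
  simp only at h1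
  rw [← h1] at h2
  simp at h2

theorem isKCNF_treeFormula {k : ℕ} {t : BinTree} (h : ∀ q ∈ t.leaves [], k ≤ q.length) :
    IsKCNF k (treeFormula k t) := by
  intro C hC
  obtain ⟨q, hq, rfl⟩ := Finset.mem_image.1 hC
  exact card_pathClause (h q hq)

/-- A clause containing the variable of `p` comes from a leaf within distance `n` of a child of `p`,
and each child accounts for at most `d`. -/
theorem occurrences_treeFormula_le {n d : ℕ} {t : BinTree} (ht : t.Bounded n d)
    (h : ∀ q ∈ t.leaves [], n + 1 ≤ q.length) (x : ℕ) :
    occurrences (treeFormula (n + 1) t) x ≤ 2 * d := by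
  by_cases hx : ∃ p : List Bool, Encodable.encode p = x
  · obtain ⟨p, rfl⟩ := hx
    refine (Finset.card_le_card (t := (t.nearLeaves [] n (true :: p) ∪
      t.nearLeaves [] n (false :: p)).image (pathClause (n + 1))) ?_).trans
      (Finset.card_image_le.trans ((Finset.card_union_le _ _).trans ?_))
    · intro C hC
      obtain ⟨hC, hv⟩ := Finset.mem_filter.1 hC
      obtain ⟨q, hq, rfl⟩ := Finset.mem_image.1 hC
      refine Finset.mem_image_of_mem _ ?_
      obtain ⟨i, hi, he⟩ := mem_vars_pathClause.1 hv
      have he := Encodable.encode_injective he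
      have hlen := h q hq
      have hmem : q ∈ t.nearLeaves [] n (q.getD i true :: p) := by
        rw [nearLeaves, Finset.mem_filter, ← he, cons_getD_drop (by omega)]
        refine ⟨hq, List.drop_suffix _ _, ?_⟩
        rw [List.length_drop]
        omega
      rw [Finset.mem_union]
      cases hb : q.getD i true with
      | true => rw [hb] at hmem; exact Or.inl hmem
      | false => rw [hb] at hmem; exact Or.inr hmem
    · have h1 := card_nearLeaves_le ht [] (true :: p)
      have h2 := card_nearLeaves_le ht [] (false :: p)
      omega
  · rw [occurrences, Finset.card_eq_zero.2]
    · exact Nat.zero_le _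
    · rw [Finset.filter_eq_empty_iff]
      intro C hC hv
      obtain ⟨q, hq, rfl⟩ := Finset.mem_image.1 hC
      obtain ⟨i, _, he⟩ := mem_vars_pathClause.1 hv
      exact hx ⟨_, he⟩

/-- Two lists neither of which is a suffix of the other branch somewhere. -/
theorem exists_branch (u : List Bool) : ∀ v : List Bool, ¬ u <:+ v → ¬ v <:+ u →
    ∃ b w, (b :: w) <:+ u ∧ ((!b) :: w) <:+ v := by
  induction u using List.reverseRecOn with
  | nil => intro v h; simp at h
  | append_singleton u x ih =>
    intro v h1 h2
    induction v using List.reverseRecOn with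
    | nil => simp at h2
    | append_singleton v y =>
      by_cases hxy : x = y
      · subst hxy
        obtain ⟨b, w, ⟨s, hs⟩, ⟨s', hs'⟩⟩ := ih v
          (fun ⟨s, hs⟩ => h1 ⟨s, by rw [← hs, List.append_assoc]⟩)
          (fun ⟨s, hs⟩ => h2 ⟨s, by rw [← hs, List.append_assoc]⟩)
        exact ⟨b, w ++ [x], ⟨s, by rw [← hs]; simp⟩, ⟨s', by rw [← hs']; simp⟩⟩
      · refine ⟨x, [], ⟨u, rfl⟩, ⟨v, ?_⟩⟩
        cases x <;> cases y <;> simp_all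

/-- A shared variable is a common ancestor of the leaves `q` and `r`, so they branch at some `w` at
or below it. Then the edge of `q` below `w` is among its last `n + 1`, and `r` is near the other
child of `w`. Only siblings are counted, whence `d` per edge rather than `2 * d`. -/
theorem maxNeighborhood_treeFormula_le {n d : ℕ} {t : BinTree} (ht : t.Bounded n d)
    (h : ∀ q ∈ t.leaves [], n + 1 ≤ q.length) :
    maxNeighborhood (treeFormula (n + 1) t) ≤ (n + 1) * d := by
  refine Finset.sup_le fun C hC => ?_
  obtain ⟨q, hq, rfl⟩ := Finset.mem_image.1 hC
  have hlen := h q hq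
  refine (Finset.card_le_card (t := ((Finset.range (n + 1)).biUnion fun i =>
    t.nearLeaves [] n ((!q.getD i true) :: q.drop (i + 1))).image (pathClause (n + 1))) ?_).trans
    (Finset.card_image_le.trans (Finset.card_biUnion_le.trans
      ((Finset.sum_le_sum fun i _ => card_nearLeaves_le ht [] _).trans (by simp))))
  intro D hD
  obtain ⟨hD, hne, x, hx⟩ := Finset.mem_filter.1 hD
  obtain ⟨r, hr, rfl⟩ := Finset.mem_image.1 hD
  refine Finset.mem_image_of_mem _ ?_
  rw [Finset.mem_inter] at hx
  obtain ⟨i, hi, hix⟩ := mem_vars_pathClause.1 hx.1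
  obtain ⟨j, hj, hjx⟩ := mem_vars_pathClause.1 hx.2
  have heq := Encodable.encode_injective (hix.trans hjx.symm)
  have hrlen := h r hr
  have hqr : q ≠ r := fun e => hne (by rw [e])
  obtain ⟨b, w, h1, h2⟩ := exists_branch q r (fun hs => hqr (eq_of_suffix_leaves hq hr hs))
    (fun hs => hqr (eq_of_suffix_leaves hr hq hs).symm)
  have hwlen := h1.length_le
  have hwlen' := h2.length_le
  simp only [List.length_cons] at hwlen hwlen'
  -- Otherwise the shared ancestor would lie below both children of `w`.
  have hpw : (q.drop (i + 1)).length ≤ w.length := by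
    by_contra hlt
    rw [not_le] at hlt
    have h3 := List.suffix_of_suffix_length_le h1 (List.drop_suffix (i + 1) q)
      (by simpa using hlt)
    have h4 := List.suffix_of_suffix_length_le h2 (List.drop_suffix (j + 1) r)
      (by rw [← heq]; simpa using hlt)
    rw [← heq] at h4
    have h5 := (List.suffix_of_suffix_length_le h3 h4 (by simp)).eq_of_length (by simp)
    simp at h5
  have hpq := congrArg List.length heq
  simp only [List.length_drop] at hpq hpw
  have hdrop : q.drop (q.length - (w.length + 1)) = b :: w := by
    have := List.suffix_iff_eq_drop.1 h1
    simpa using this.symm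
  have hs := cons_getD_drop (q := q) (i := q.length - (w.length + 1)) (by omega)
  rw [hdrop] at hs
  obtain ⟨hb, hw⟩ := List.cons.inj hs
  rw [Finset.mem_biUnion]
  refine ⟨q.length - (w.length + 1), Finset.mem_range.2 (by omega), ?_⟩
  rw [hb, hw, nearLeaves, Finset.mem_filter]
  refine ⟨hr, h2, ?_⟩
  simp only [List.length_cons]
  omega

/-- A tree all of whose leaves have depth more than `n`, and each vertex of which has at most `d`
leaf descendants at distance at most `n`, gives an unsatisfiable formula. -/
theorem exists_unsatisfiable {n d : ℕ} (h : Constructible n d fun _ => 0) :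
    ∃ F : CNF ℕ, IsKSCNF (n + 1) (2 * d) F ∧ maxNeighborhood F ≤ (n + 1) * d ∧
      ¬ Satisfiable F := by
  obtain ⟨t, ht, h0⟩ := h
  have hlen : ∀ q ∈ t.leaves [], n + 1 ≤ q.length := by
    intro q hq
    by_contra hlt
    have h1 := t.card_leaves_filter_length [] q.length
    have h2 := h0 (n - q.length) (by omega)
    rw [Nat.sub_sub_self (by omega)] at h2
    have h3 := Finset.card_eq_zero.1 (Nat.le_zero.1 (h1.trans h2))
    rw [Finset.filter_eq_empty_iff] at h3
    exact h3 hq (by simp)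
  exact ⟨treeFormula (n + 1) t,
    ⟨isKCNF_treeFormula hlen, occurrences_treeFormula_le ht hlen⟩,
    maxNeighborhood_treeFormula_le ht hlen, not_satisfiable_treeFormula hlen⟩

/-! ### Existence of the maxima -/

theorem zero_mem_fSet {k : ℕ} (hk : 0 < k) : 0 ∈ fSet k := by
  rintro F ⟨hF, hocc⟩
  refine ⟨fun _ => true, fun C hC => ?_⟩
  obtain ⟨u, hu⟩ := Finset.card_pos.1 (by rw [hF C hC]; exact hk : 0 < C.card)
  have h1 := Nat.le_zero.1 (hocc u.1)
  rw [occurrences, Finset.card_eq_zero, Finset.filter_eq_empty_iff] at h1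
  exact (h1 hC (Finset.mem_image_of_mem _ hu)).elim

/-- Clauses without neighbours have disjoint variables, so one literal of each can be made true
independently. -/
theorem zero_mem_lSet {k : ℕ} (hk : 0 < k) : 0 ∈ lSet k := by
  classical
  intro F hF hnb
  have hne : ∀ C ∈ F, ∃ u, u ∈ C := fun C hC =>
    Finset.card_pos.1 (by rw [hF C hC]; exact hk : 0 < C.card)
  have hdisj : ∀ C ∈ F, ∀ D ∈ F, ∀ u ∈ C, ∀ v ∈ D, u.1 = v.1 → C = D := by
    intro C hC D hD u hu v hv huv
    by_contra hCD
    have h1 : (neighborhood F C).card ≤ 0 :=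
      (Finset.le_sup (f := fun C => (neighborhood F C).card) hC).trans hnb
    have h2 := Finset.card_eq_zero.1 (Nat.le_zero.1 h1)
    rw [neighborhood, Finset.filter_eq_empty_iff] at h2
    refine h2 hD ⟨Ne.symm hCD, u.1, Finset.mem_inter.2 ⟨Finset.mem_image_of_mem _ hu, ?_⟩⟩
    rw [huv]
    exact Finset.mem_image_of_mem _ hv
  choose! g hg using hne
  refine ⟨fun x => decide (∃ C ∈ F, g C = (x, true)), fun C hC => ⟨g C, hg C hC, ?_⟩⟩
  cases hb : (g C).2 with
  | true =>
    rw [decide_eq_true_iff]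
    exact ⟨C, hC, Prod.ext rfl hb⟩
  | false =>
    rw [decide_eq_false_iff_not]
    rintro ⟨D, hD, hgD⟩
    have h1 := hdisj C hC D hD _ (hg C hC) _ (hg D hD) (by rw [hgD])
    rw [← h1] at hgD
    rw [hgD] at hb
    simp at hb

theorem isGreatest_sSup_of_lt {A : Set ℕ} (h0 : 0 ∈ A) {M : ℕ} (hM : ∀ a ∈ A, a < M) :
    IsGreatest A (sSup A) ∧ sSup A + 1 ≤ M := by
  have hb : BddAbove A := ⟨M, fun a ha => (hM a ha).le⟩
  have hm := Nat.sSup_mem ⟨0, h0⟩ hb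
  exact ⟨⟨hm, fun a ha => le_csSup hb ha⟩, hM _ hm⟩


/-! ### Parameters and conclusion -/

/-- With `u = 2 ^ (m - 6)` one has `2 ^ m = 64 * u`, `k = 63 * u` and `L = 2 * u`. Thus 31 blocks
take `62 * u` positions and leave about `u` for `room`, while 32 blocks would exceed `k`. -/
theorem Scale.of_two_pow {k m : ℕ} (hm : 20 ≤ m) (hk : 64 * k = 63 * 2 ^ m) :
    m + 1 ≤ k - 1 ∧ Scale (k - 1) (2 ^ (k - 1 - m)) (2 ^ (m - 5)) := by
  obtain ⟨r, rfl⟩ : ∃ r, m = r + 11 + 6 := ⟨m - 17, by omega⟩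
  have hr : r < 2 ^ r := Nat.lt_two_pow_self
  have e1 : 2 ^ (r + 11 + 6) = 64 * (2048 * 2 ^ r) := by
    rw [pow_add, pow_add]
    ring
  have e2 : 2 ^ (r + 11 + 6 - 5) = 2 * (2048 * 2 ^ r) := by
    rw [show r + 11 + 6 - 5 = r + 12 by omega, pow_add]
    ring
  rw [e1] at hk
  have hkm : r + 11 + 6 + 1 ≤ k - 1 := by omega
  refine ⟨hkm, by omega, ?_, ?_, by omega⟩
  · have h32 : ∀ a b e : ℕ, e = 5 + (a + b) → 32 * (2 ^ a * 2 ^ b) = 2 ^ e := by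
      rintro a b e rfl
      rw [pow_add, pow_add]
      norm_num
    exact h32 _ _ _ (by omega)
  · obtain ⟨s, hs⟩ : ∃ s, k - 1 - (r + 11 + 6) = s + 1 := ⟨k - 1 - (r + 11 + 6) - 1, by omega⟩
    rw [hs, pow_succ]
    omega

end KSat

theorem theorem1p12 (c : ℝ) (hc : c = 64 / 63) :
    ∃ K : ℕ, ∀ k : ℕ, K ≤ k → (∃ m : ℕ, c * (k : ℝ) = 2 ^ m) →
      (IsGreatest (KSat.fSet k) (KSat.f k) ∧
        (KSat.f k : ℝ) ≤ (2 : ℝ) ^ k / (c * (k : ℝ)) - 1) ∧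
      (IsGreatest (KSat.lSet k) (KSat.l k) ∧
        (KSat.l k : ℝ) ≤ (2 : ℝ) ^ (k - 1) / c - 1) := by
  refine ⟨2 ^ 20, fun k hK ⟨m, hm⟩ => ?_⟩
  have hkm : 64 * k = 63 * 2 ^ m := by
    rw [hc] at hm
    have : (64 * k : ℝ) = 63 * 2 ^ m := by rw [← hm]; ring
    exact_mod_cast this
  have hm20 : 20 ≤ m := by
    rw [← Nat.pow_le_pow_iff_right (by norm_num : 1 < 2)]
    omega
  obtain ⟨hmk, hs⟩ := KSat.Scale.of_two_pow hm20 hkm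
  obtain ⟨F, hF, hnb, hunsat⟩ := KSat.exists_unsatisfiable hs.constructible_zero
  have hk0 : 0 < k := by omega
  rw [Nat.sub_add_cancel hk0] at hF hnb
  have hf := KSat.isGreatest_sSup_of_lt (KSat.zero_mem_fSet hk0)
    (M := 2 * 2 ^ (k - 1 - m)) fun s hs => by
      by_contra hle
      exact hunsat (hs F ⟨hF.1, fun x => (hF.2 x).trans (not_lt.1 hle)⟩)
  have hl := KSat.isGreatest_sSup_of_lt (KSat.zero_mem_lSet hk0)
    (M := k * 2 ^ (k - 1 - m)) fun s hs => by
      by_contra hle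
      exact hunsat (hs F hF.1 (hnb.trans (not_lt.1 hle)))
  have hpow : (2 : ℝ) ^ (k - 1) = 2 ^ (k - 1 - m) * 2 ^ m := by
    rw [← pow_add]
    congr 1
    omega
  have hpow' : (2 : ℝ) ^ k = 2 * 2 ^ (k - 1) := by
    rw [← pow_succ']
    congr 1
    omega
  refine ⟨⟨hf.1, ?_⟩, hl.1, ?_⟩
  · have h1 : ((sSup (KSat.fSet k) : ℕ) : ℝ) + 1 ≤ 2 * 2 ^ (k - 1 - m) := by exact_mod_cast hf.2
    have h2 : (2 : ℝ) ^ k / (c * k) = 2 * 2 ^ (k - 1 - m) := by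
      rw [hm, hpow', hpow, div_eq_iff (by positivity)]
      ring
    rw [h2]
    exact le_sub_iff_add_le.2 h1
  · have h1 : ((sSup (KSat.lSet k) : ℕ) : ℝ) + 1 ≤ k * 2 ^ (k - 1 - m) := by exact_mod_cast hl.2
    have h2 : (2 : ℝ) ^ (k - 1) / c = k * 2 ^ (k - 1 - m) := by
      rw [hpow, ← hm, div_eq_iff (by rw [hc]; norm_num)]
      ring
    rw [h2]
    exact le_sub_iff_add_le.2 h1
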